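/- Let $n\ge 1$, let $S^{n-1}=\{u\in\mathbb R^n:|u|=1\}$ be the Euclidean unit sphere, and let $Z$ be a finite nonnegative Borel measure on $S^{n-1}$ that is isotropic, i.e. $|x|^2=\int_{S^{n-1}}|x\cdot u|^2\,dZ(u)$ for all $x\in\mathbb R^n$, and whose centroid $\frac{1}{Z(S^{n-1})}\int_{S^{n-1}}u\,dZ(u)$ is the origin. Let $Z_\infty=\operatorname{conv}(\operatorname{supp} Z)\subset\mathbb R^n$ be the convex hull of the support of $Z$, and let $|Z_\infty|$ be its $n$-dimensional volume. Then $$|Z_\infty|\ \ge\ \frac{(n+1)^{(n+1)/2}\,n^{-n/2}}{n!},$$ with equality if and only if $Z_\infty$ is a regular $n$-simplex inscribed in $S^{n-1}$ (that is, with all its vertices on $S^{n-1}$). -/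

import Mathlib

open MeasureTheory

/-- A finite Borel measure `Z` on the unit sphere of `ℝⁿ` is isotropic if
`‖x‖² = ∫ |x ⬝ u|² dZ(u)` for all `x ∈ ℝⁿ`. -/
structure IsIsotropic {n : ℕ}
    (Z : Measure (Metric.sphere (0 : EuclideanSpace ℝ (Fin n)) 1)) : Prop where
  isFiniteMeasure : IsFiniteMeasure Z
  norm_sq_eq : ∀ x : EuclideanSpace ℝ (Fin n),
    ‖x‖ ^ 2 = ∫ u, |inner ℝ x (u : EuclideanSpace ℝ (Fin n))| ^ 2 ∂Z

/-- The centroid `Z(Sⁿ⁻¹)⁻¹ ∫ u dZ(u)` of a measure on the unit sphere. -/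
noncomputable def sphereCentroid {n : ℕ}
    (Z : Measure (Metric.sphere (0 : EuclideanSpace ℝ (Fin n)) 1)) :
    EuclideanSpace ℝ (Fin n) :=
  (1 / Z.real Set.univ) • ∫ u, (u : EuclideanSpace ℝ (Fin n)) ∂Z

/-- The convex hull in `ℝⁿ` of the support of a measure on the unit sphere. -/
def supportBody {n : ℕ}
    (Z : Measure (Metric.sphere (0 : EuclideanSpace ℝ (Fin n)) 1)) :
    Set (EuclideanSpace ℝ (Fin n)) :=
  convexHull ℝ ((fun u => (u : EuclideanSpace ℝ (Fin n))) '' Z.support)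

/-- `K` is a regular `n`-simplex in `ℝⁿ` whose vertices all lie on the unit sphere. -/
def IsInscribedRegularSimplex {n : ℕ} (K : Set (EuclideanSpace ℝ (Fin n))) : Prop :=
  ∃ s : Affine.Simplex ℝ (EuclideanSpace ℝ (Fin n)) n,
    s.Regular ∧ (∀ i, s.points i ∈ Metric.sphere (0 : EuclideanSpace ℝ (Fin n)) 1) ∧
      K = convexHull ℝ (Set.range s.points)

/-! The proof follows Ball and Barthe's mass-transport method in one dimension more, where a centred
isotropic measure lifts to a decomposition of the identity.

`sphereLift` sends the sphere to unit vectors of `ℝ × ℝⁿ` on a common parallel. Its scaling is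
chosen so that isotropy and the vanishing centroid give `∫ w ⊗ w = n / (n + 1) • id` over the lifts
`w`. Averages lie in convex hulls, so Carathéodory's theorem yields finitely many support points `u
i` and weights `c i > 0` with `∑ c i • w i ⊗ w i = id` (`exists_finite_frame`). It suffices to bound
the volume of their hull `K`, which is contained in `supportBody Z`.

Weighting `coneOver K` by `exp (-⟪a, x⟫)`, with `a = liftAxis n`, and slicing by height gives the
volume of `K` divided by that of the regular simplex (`lintegral_coneOver`). This integral must be
shown to be at least `1`. Let `φ` transport the Gaussian to the exponential density. The map `x ↦ ∑
c i φ(⟪w i, x⟫) w i` is injective with values in the cone. Since `⟪a, w i⟫ = 1`, the one-dimensional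
transport identities multiply, and the determinant inequality `det_frameOp_ge` bounds the
transported density below by the Gaussian of total mass `1` (`one_le_lintegral_cone`).

Equality forces the distinct `w i` to be orthogonal, hence an orthonormal basis, which is the lift
of a regular simplex; the larger hull then has no room beyond `K`. Conversely, an inscribed regular
simplex has orthonormal lifts, and the cone over it lies in an orthant of weighted volume `1`. -/

open Real Set in
/-- The Gaussian tail `∫ₜ^∞ exp (-π s²) ds`. -/
noncomputable def gaussTail (t : ℝ) : ℝ := ∫ s in Ioi t, exp (-π * s ^ 2)

open Real in
/-- The transport map carrying the density `exp (-π t²)` on `ℝ` to the density `exp (-t)` on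
`(0, ∞)`. -/
noncomputable def gaussToExp (t : ℝ) : ℝ := -log (gaussTail t)

open Real in
/-- The derivative of `gaussToExp`. -/
noncomputable def gaussHazard (t : ℝ) : ℝ := exp (-π * t ^ 2) / gaussTail t

/-! ### One-dimensional transport from the Gaussian to the exponential density. -/

section GaussTail
open Real Set

theorem integrable_gauss : Integrable (fun s : ℝ => exp (-π * s ^ 2)) :=
  integrable_exp_neg_mul_sq pi_pos

theorem gaussTail_eq (t : ℝ) :
    gaussTail t = gaussTail 0 - ∫ s in (0 : ℝ)..t, exp (-π * s ^ 2) := by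
  unfold gaussTail
  rw [← intervalIntegral.integral_Ioi_sub_Ioi' integrable_gauss.integrableOn
    integrable_gauss.integrableOn]
  ring

theorem hasDerivAt_gaussTail (t : ℝ) : HasDerivAt gaussTail (-exp (-π * t ^ 2)) t := by
  have hc : Continuous (fun s : ℝ => exp (-π * s ^ 2)) := by fun_prop
  have h := (hc.integral_hasStrictDerivAt 0 t).hasDerivAt.const_sub (gaussTail 0)
  rwa [← funext gaussTail_eq] at h

theorem gaussTail_pos (t : ℝ) : 0 < gaussTail t := by
  unfold gaussTail
  rw [setIntegral_pos_iff_support_of_nonneg_ae (ae_of_all _ fun s => (exp_pos _).le)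
    integrable_gauss.integrableOn]
  have : Function.support (fun s : ℝ => exp (-π * s ^ 2)) = univ := by
    ext s; simp [(exp_pos _).ne']
  rw [this, univ_inter]
  simp

/-- The tails at `t` and `-t` add up to the total Gaussian mass `1`. This makes `gaussToExp`
positive, which keeps the later transport inside the cone. -/
theorem gaussTail_lt_one (t : ℝ) : gaussTail t < 1 := by
  have h1 : gaussTail t + gaussTail (-t) = 1 := by
    have : gaussTail (-t) = ∫ s in Iic t, exp (-π * s ^ 2) := by
      unfold gaussTail
      rw [← integral_comp_neg_Iic t (fun s : ℝ => exp (-π * s ^ 2))]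
      simp
    rw [this]
    unfold gaussTail
    rw [add_comm, intervalIntegral.integral_Iic_add_Ioi integrable_gauss.integrableOn
      integrable_gauss.integrableOn, integral_gaussian, div_self pi_pos.ne', sqrt_one]
  linarith [gaussTail_pos (-t)]

theorem gaussToExp_pos (t : ℝ) : 0 < gaussToExp t :=
  neg_pos.2 (log_neg (gaussTail_pos t) (gaussTail_lt_one t))

theorem gaussHazard_pos (t : ℝ) : 0 < gaussHazard t := div_pos (exp_pos _) (gaussTail_pos t)

theorem continuous_gaussTail : Continuous gaussTail :=
  continuous_iff_continuousAt.2 fun t => (hasDerivAt_gaussTail t).continuousAt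

theorem continuous_gaussHazard : Continuous gaussHazard :=
  (by fun_prop : Continuous fun t : ℝ => exp (-π * t ^ 2)).div continuous_gaussTail
    fun t => (gaussTail_pos t).ne'

theorem hasDerivAt_gaussToExp (t : ℝ) : HasDerivAt gaussToExp (gaussHazard t) t := by
  have h := ((hasDerivAt_gaussTail t).log (gaussTail_pos t).ne').neg
  refine h.congr_deriv ?_
  unfold gaussHazard
  ring

/-- The change-of-variables equation `φ' exp (-φ) = exp (-π t²)` for `φ = gaussToExp`. -/
theorem gaussHazard_mul_exp_neg (t : ℝ) :
    gaussHazard t * exp (-gaussToExp t) = exp (-π * t ^ 2) := by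
  unfold gaussHazard gaussToExp
  rw [neg_neg, exp_log (gaussTail_pos t), div_mul_cancel₀ _ (gaussTail_pos t).ne']

theorem strictMono_gaussToExp : StrictMono gaussToExp :=
  strictMono_of_hasDerivAt_pos hasDerivAt_gaussToExp gaussHazard_pos

/-- Differentiating `exp (-π t²) = k * gaussTail t` would give `2 π t = k` for every `t`. This
rigidity drives the equality case. -/
theorem not_forall_gaussHazard_eq (k : ℝ) : ¬ ∀ t, gaussHazard t = k := by
  intro h
  have h1 : ∀ t, exp (-π * t ^ 2) = k * gaussTail t := fun t => by
    rw [← h t, gaussHazard, div_mul_cancel₀ _ (gaussTail_pos t).ne']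
  have h2 : ∀ t : ℝ, 2 * π * t = k := fun t => by
    have d1 : HasDerivAt (fun t : ℝ => exp (-π * t ^ 2)) (exp (-π * t ^ 2) * (-π * (2 * t))) t := by
      have := ((hasDerivAt_pow 2 t).const_mul (-π)).exp
      simpa using this
    have d2 := (hasDerivAt_gaussTail t).const_mul k
    rw [← funext h1] at d2
    have h3 := d1.unique d2
    have h4 := exp_pos (-π * t ^ 2)
    have : exp (-π * t ^ 2) * (2 * π * t - k) = 0 := by linarith
    rcases mul_eq_zero.1 this with h5 | h5
    · exact absurd h5 h4.ne'
    · linarith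
  have e0 := h2 0
  have e1 := h2 1
  have := pi_pos
  linarith

end GaussTail

/-! ### The determinant inequality for decompositions of the identity. -/

section WeightedFrame
open Real Finset

variable {W : Type*} [NormedAddCommGroup W] [InnerProductSpace ℝ W]
variable {ι : Type*} [Fintype ι]

/-- The operator `∑ i, t i • w i ⊗ w i`. -/
noncomputable def frameOp (w : ι → W) (t : ι → ℝ) : W →L[ℝ] W :=
  ∑ i, t i • InnerProductSpace.rankOne ℝ (w i) (w i)

theorem frameOp_apply (w : ι → W) (t : ι → ℝ) (x : W) :
    frameOp w t x = ∑ i, (t i * inner ℝ (w i) x) • w i := by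
  simp [frameOp, smul_smul]

theorem inner_frameOp (w : ι → W) (t : ι → ℝ) (x y : W) :
    inner ℝ (frameOp w t x) y = ∑ i, t i * inner ℝ (w i) x * inner ℝ (w i) y := by
  simp [frameOp_apply, sum_inner, inner_smul_left]

theorem isSymmetric_frameOp (w : ι → W) (t : ι → ℝ) :
    ((frameOp w t : W →L[ℝ] W) : W →ₗ[ℝ] W).IsSymmetric := by
  intro x y
  rw [ContinuousLinearMap.coe_coe, inner_frameOp, real_inner_comm, inner_frameOp]
  exact sum_congr rfl fun i _ => by ring

variable [FiniteDimensional ℝ W]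

/-- **Ball–Barthe determinant inequality** for a decomposition of the identity
`∑ i, c i • w i ⊗ w i = id` by unit vectors, with its equality case. -/
theorem det_frameOp_ge {c : ι → ℝ} {w : ι → W} (hc : ∀ i, 0 < c i) (hw : ∀ i, ‖w i‖ = 1)
    (hI : ∀ x, ∑ i, c i * inner ℝ (w i) x ^ 2 = ‖x‖ ^ 2) {t : ι → ℝ} (ht : ∀ i, 0 < t i) :
    ∏ i, t i ^ c i ≤ (frameOp w fun i => c i * t i).det ∧
      (∏ i, t i ^ c i = (frameOp w fun i => c i * t i).det →
        ∀ i j, t i ≠ t j → inner ℝ (w i) (w j) = 0) := by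
  have hS := isSymmetric_frameOp w fun i => c i * t i
  set e := hS.eigenvectorBasis rfl with he
  set lam := hS.eigenvalues rfl with hlam
  have hdet : (frameOp w fun i => c i * t i).det = ∏ k, lam k := by
    rw [ContinuousLinearMap.det, hS.det_eq_prod_eigenvalues rfl]
    simp [hlam]
  have hlam_eq : ∀ k, lam k = ∑ i, c i * inner ℝ (w i) (e k) ^ 2 * t i := by
    intro k
    have h1 := inner_frameOp w (fun i => c i * t i) (e k) (e k)
    have h2 : frameOp w (fun i => c i * t i) (e k) = lam k • e k :=
      hS.apply_eigenvectorBasis rfl k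
    rw [h2, inner_smul_left, real_inner_self_eq_norm_sq, e.orthonormal.1 k] at h1
    simp only [conj_trivial, one_pow, mul_one] at h1
    rw [h1]
    exact sum_congr rfl fun i _ => by ring
  have hsum : ∀ k, ∑ i, c i * inner ℝ (w i) (e k) ^ 2 = 1 := fun k => by
    rw [hI, e.orthonormal.1 k, one_pow]
  have hnn : ∀ k, ∀ i ∈ univ, 0 ≤ c i * inner ℝ (w i) (e k) ^ 2 := fun k i _ =>
    mul_nonneg (hc i).le (sq_nonneg _)
  -- Each eigenvalue is a mean of the `t i` with weights `c i * ⟪w i, e k⟫²`, so AM-GM applies.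
  -- Summed over `k`, these weights give `c i` because `w i` is a unit vector.
  have hgeom : ∀ k, ∏ i, t i ^ (c i * inner ℝ (w i) (e k) ^ 2) ≤ lam k := fun k => by
    rw [hlam_eq]
    exact geom_mean_le_arith_mean_weighted univ _ t (hnn k) (hsum k) fun i _ => (ht i).le
  have hpos : ∀ k, 0 < ∏ i, t i ^ (c i * inner ℝ (w i) (e k) ^ 2) := fun k =>
    prod_pos fun i _ => rpow_pos_of_pos (ht i) _
  have hprod : ∏ i, t i ^ c i = ∏ k, ∏ i, t i ^ (c i * inner ℝ (w i) (e k) ^ 2) := by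
    rw [prod_comm]
    refine prod_congr rfl fun i _ => ?_
    rw [← rpow_sum_of_pos (ht i), ← mul_sum]
    have : ∑ k, inner ℝ (w i) (e k) ^ 2 = 1 := by
      have := e.sum_sq_norm_inner_left (w i)
      simpa [hw i] using this
    rw [this, mul_one]
  refine ⟨?_, fun heq i j hij => ?_⟩
  · rw [hprod, hdet]
    exact prod_le_prod (fun k _ => (hpos k).le) fun k _ => hgeom k
  · have hk : ∀ k, ∏ i, t i ^ (c i * inner ℝ (w i) (e k) ^ 2) = lam k := by
      by_contra! hne
      obtain ⟨k, hk⟩ := hne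
      rw [hprod, hdet] at heq
      exact heq.not_lt (prod_lt_prod (fun k _ => hpos k) (fun k _ => hgeom k)
        ⟨k, mem_univ k, lt_of_le_of_ne (hgeom k) hk⟩)
    -- If `⟪w i, w j⟫ ≠ 0`, some `e k` meets both vectors, so both weights are nonzero in that mean
    -- and equality in AM-GM forces `t i = t j`.
    rw [← e.sum_inner_mul_inner]
    refine sum_eq_zero fun k _ => ?_
    by_contra hne
    apply hij
    have h1 := hk k
    rw [hlam_eq, geom_mean_eq_arith_mean_weighted_iff_of_nonneg univ _ t (hnn k) (hsum k)
      fun i _ => (ht i).le] at h1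
    refine h1 i (mem_univ i) ?_ j (mem_univ j) ?_
    · exact mul_ne_zero (hc i).ne' (pow_ne_zero 2 (left_ne_zero_of_mul hne))
    · rw [real_inner_comm]
      exact mul_ne_zero (hc j).ne' (pow_ne_zero 2 (right_ne_zero_of_mul hne))

end WeightedFrame

/-! ### Transport of the Gaussian into a cone. -/

section Transport
open Real Finset

variable {W : Type*} [NormedAddCommGroup W] [InnerProductSpace ℝ W]
variable {ι : Type*} [Fintype ι]

/-- The transport map `x ↦ ∑ i, c i φ(⟪w i, x⟫) w i`, with `φ = gaussToExp`, from `W` into the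
cone spanned by the vectors `w i`. -/
noncomputable def coneTransport (c : ι → ℝ) (w : ι → W) (x : W) : W :=
  ∑ i, (c i * gaussToExp (inner ℝ (w i) x)) • w i

theorem hasFDerivAt_coneTransport (c : ι → ℝ) (w : ι → W) (x : W) :
    HasFDerivAt (coneTransport c w)
      (frameOp w fun i => c i * gaussHazard (inner ℝ (w i) x)) x := by
  unfold coneTransport frameOp
  refine HasFDerivAt.fun_sum fun i _ => ?_
  have h1 : HasFDerivAt (fun x => inner ℝ (w i) x) (innerSL ℝ (w i)) x :=
    (innerSL ℝ (w i)).hasFDerivAt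
  have h2 := (((hasDerivAt_gaussToExp (inner ℝ (w i) x)).comp_hasFDerivAt x h1).const_mul
    (c i)).smul_const (w i)
  refine h2.congr_fderiv ?_
  ext y
  simp [smul_smul, mul_assoc]

/-- Monotonicity: pairing the difference of two images with `x - y` gives a sum of nonnegative
terms. If it vanishes, strict monotonicity of `gaussToExp` makes `x - y` orthogonal to every `w i`,
hence zero. -/
theorem injective_coneTransport {c : ι → ℝ} {w : ι → W} (hc : ∀ i, 0 < c i)
    (hI : ∀ x, ∑ i, c i * inner ℝ (w i) x ^ 2 = ‖x‖ ^ 2) :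
    Function.Injective (coneTransport c w) := by
  intro x y hxy
  have h0 : ∑ i, c i * ((gaussToExp (inner ℝ (w i) x) - gaussToExp (inner ℝ (w i) y)) *
      (inner ℝ (w i) x - inner ℝ (w i) y)) = 0 := by
    have : inner ℝ (coneTransport c w x - coneTransport c w y) (x - y) = 0 := by
      rw [hxy, sub_self, inner_zero_left]
    rw [← this, coneTransport, coneTransport, ← sum_sub_distrib, sum_inner]
    refine sum_congr rfl fun i _ => ?_
    rw [← sub_smul, inner_smul_left, inner_sub_right]
    simp only [conj_trivial]
    ring
  have hnn : ∀ a b : ℝ, 0 ≤ (gaussToExp a - gaussToExp b) * (a - b) := fun a b => by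
    rcases le_total a b with h | h
    · exact mul_nonneg_of_nonpos_of_nonpos
        (sub_nonpos.2 (strictMono_gaussToExp.monotone h)) (sub_nonpos.2 h)
    · exact mul_nonneg (sub_nonneg.2 (strictMono_gaussToExp.monotone h)) (sub_nonneg.2 h)
  rw [sum_eq_zero_iff_of_nonneg fun i _ => mul_nonneg (hc i).le (hnn _ _)] at h0
  have h1 : ∀ i, inner ℝ (w i) (x - y) = 0 := fun i => by
    rw [inner_sub_right]
    rcases mul_eq_zero.1 ((mul_eq_zero.1 (h0 i (mem_univ i))).resolve_left (hc i).ne') with h | h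
    · exact sub_eq_zero.2 (strictMono_gaussToExp.injective (sub_eq_zero.1 h))
    · exact h
  have h2 := hI (x - y)
  simp only [h1, ne_eq, OfNat.ofNat_ne_zero, not_false_eq_true, zero_pow, mul_zero,
    sum_const_zero] at h2
  exact sub_eq_zero.1 (norm_eq_zero.1 (pow_eq_zero_iff two_ne_zero |>.1 h2.symm))

variable [FiniteDimensional ℝ W]

/-- As `⟪a, w i⟫ = 1`, the exponential weight factors over `i`. The `c i`-th powers of the
one-dimensional identities multiply to `exp (-π ‖x‖²)`, leaving only the determinant inequality. -/
theorem gauss_le_det_mul_exp {c : ι → ℝ} {w : ι → W} (hc : ∀ i, 0 < c i) (hw : ∀ i, ‖w i‖ = 1)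
    (hI : ∀ x, ∑ i, c i * inner ℝ (w i) x ^ 2 = ‖x‖ ^ 2) {a : W}
    (ha : ∀ i, inner ℝ a (w i) = 1) (x : W) :
    exp (-π * ‖x‖ ^ 2) ≤ (frameOp w fun i => c i * gaussHazard (inner ℝ (w i) x)).det *
        exp (-inner ℝ a (coneTransport c w x)) ∧
      (exp (-π * ‖x‖ ^ 2) = (frameOp w fun i => c i * gaussHazard (inner ℝ (w i) x)).det *
          exp (-inner ℝ a (coneTransport c w x)) →
        ∀ i j, gaussHazard (inner ℝ (w i) x) ≠ gaussHazard (inner ℝ (w j) x) →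
          inner ℝ (w i) (w j) = 0) := by
  have h := det_frameOp_ge hc hw hI fun i => gaussHazard_pos (inner ℝ (w i) x)
  have hexp : inner ℝ a (coneTransport c w x) = ∑ i, c i * gaussToExp (inner ℝ (w i) x) := by
    simp [coneTransport, inner_sum, inner_smul_right, ha]
  have heq : exp (-π * ‖x‖ ^ 2) = (∏ i, gaussHazard (inner ℝ (w i) x) ^ c i) *
      exp (-inner ℝ a (coneTransport c w x)) := by
    rw [hexp, ← hI, mul_sum, ← sum_neg_distrib, exp_sum, exp_sum, ← prod_mul_distrib]
    refine prod_congr rfl fun i _ => ?_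
    have : exp (-(c i * gaussToExp (inner ℝ (w i) x))) =
        exp (-gaussToExp (inner ℝ (w i) x)) ^ c i := by
      rw [← exp_mul]; ring_nf
    rw [this, ← mul_rpow (gaussHazard_pos _).le (exp_pos _).le, gaussHazard_mul_exp_neg,
      ← exp_mul]
    ring_nf
  refine ⟨?_, fun h1 => h.2 ?_⟩
  · rw [heq]
    exact mul_le_mul_of_nonneg_right h.1 (exp_pos _).le
  · rw [heq] at h1
    exact mul_right_cancel₀ (exp_pos _).ne' h1

variable [MeasurableSpace W] [BorelSpace W]

theorem lintegral_gauss_eq_one :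
    ∫⁻ x : W, ENNReal.ofReal (exp (-π * ‖x‖ ^ 2)) = 1 := by
  have h := GaussianFourier.integral_rexp_neg_mul_sq_norm (V := W) pi_pos
  rw [div_self pi_pos.ne', one_rpow] at h
  rw [← ofReal_integral_eq_lintegral_ofReal _ (ae_of_all _ fun x => (exp_pos _).le), h,
    ENNReal.ofReal_one]
  by_contra hni
  rw [integral_undef hni] at h
  exact zero_ne_one h

/-- The cone spanned by the unit vectors of a decomposition of the identity has weighted volume
at least `1`; if it is exactly `1`, then distinct vectors are orthogonal. -/
theorem one_le_lintegral_cone {c : ι → ℝ} {w : ι → W} (hc : ∀ i, 0 < c i) (hw : ∀ i, ‖w i‖ = 1)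
    (hI : ∀ x, ∑ i, c i * inner ℝ (w i) x ^ 2 = ‖x‖ ^ 2) {a : W}
    (ha : ∀ i, inner ℝ a (w i) = 1) {C : Set W}
    (hC : ∀ θ : ι → ℝ, (∀ i, 0 < θ i) → ∑ i, θ i • w i ∈ C) :
    1 ≤ ∫⁻ x in C, ENNReal.ofReal (exp (-inner ℝ a x)) ∧
      (∫⁻ x in C, ENNReal.ofReal (exp (-inner ℝ a x)) = 1 →
        ∀ i j, w i ≠ w j → inner ℝ (w i) (w j) = 0) := by
  set D : W → ℝ := fun x => (frameOp w fun i => c i * gaussHazard (inner ℝ (w i) x)).det with hD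
  have hpt := gauss_le_det_mul_exp hc hw hI ha
  have hDpos : ∀ x, 0 ≤ D x := fun x =>
    (prod_nonneg fun i _ => rpow_nonneg (gaussHazard_pos (inner ℝ (w i) x)).le _).trans
      (det_frameOp_ge hc hw hI fun i => gaussHazard_pos (inner ℝ (w i) x)).1
  have hchange : ∫⁻ x in Set.range (coneTransport c w), ENNReal.ofReal (exp (-inner ℝ a x)) =
      ∫⁻ x, ENNReal.ofReal (D x * exp (-inner ℝ a (coneTransport c w x))) := by
    rw [← Set.image_univ, lintegral_image_eq_lintegral_abs_det_fderiv_mul volume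
      MeasurableSet.univ (fun x _ => (hasFDerivAt_coneTransport c w x).hasFDerivWithinAt)
      (injective_coneTransport hc hI).injOn, setLIntegral_univ]
    refine lintegral_congr fun x => ?_
    rw [abs_of_nonneg (hDpos x), ENNReal.ofReal_mul (hDpos x)]
  have hsub : Set.range (coneTransport c w) ⊆ C := by
    rintro _ ⟨x, rfl⟩
    exact hC _ fun i => mul_pos (hc i) (gaussToExp_pos _)
  have hmono : ∫⁻ x, ENNReal.ofReal (D x * exp (-inner ℝ a (coneTransport c w x))) ≤
      ∫⁻ x in C, ENNReal.ofReal (exp (-inner ℝ a x)) := by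
    rw [← hchange]
    exact lintegral_mono_set hsub
  have hle : ∀ x, ENNReal.ofReal (exp (-π * ‖x‖ ^ 2)) ≤
      ENNReal.ofReal (D x * exp (-inner ℝ a (coneTransport c w x))) := fun x =>
    ENNReal.ofReal_le_ofReal (hpt x).1
  refine ⟨?_, fun heq i j hij => ?_⟩
  · rw [← lintegral_gauss_eq_one (W := W)]
    exact (lintegral_mono hle).trans hmono
  · have hTc : Continuous (coneTransport c w) := continuous_iff_continuousAt.2 fun x =>
      (hasFDerivAt_coneTransport c w x).continuousAt
    have hDc : Continuous D := by
      refine ContinuousLinearMap.continuous_det.comp ?_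
      unfold frameOp
      refine continuous_finsetSum _ fun i _ => ?_
      have : Continuous fun x => c i * gaussHazard (inner ℝ (w i) x) :=
        continuous_const.mul (continuous_gaussHazard.comp (by fun_prop))
      exact this.smul continuous_const
    have hFc : Continuous fun x => D x * exp (-inner ℝ a (coneTransport c w x)) := by fun_prop
    have hae := ae_eq_of_ae_le_of_lintegral_le (ae_of_all volume hle)
      (by rw [lintegral_gauss_eq_one]; exact ENNReal.one_ne_top)
      (ENNReal.continuous_ofReal.comp hFc).aemeasurable
      (by rw [lintegral_gauss_eq_one, ← heq]; exact hmono)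
    -- Both densities are continuous, so equality of integrals gives equality at every point, not
    -- merely almost everywhere.
    have hae' := (Continuous.ae_eq_iff_eq volume
      (ENNReal.continuous_ofReal.comp (by fun_prop : Continuous fun x : W => exp (-π * ‖x‖ ^ 2)))
      (ENNReal.continuous_ofReal.comp hFc)).1 hae
    have hall : ∀ x, exp (-π * ‖x‖ ^ 2) = D x * exp (-inner ℝ a (coneTransport c w x)) :=
      fun x => (ENNReal.ofReal_eq_ofReal_iff (exp_pos _).le
        (mul_nonneg (hDpos x) (exp_pos _).le)).1 (congrFun hae' x)
    by_contra hne
    have hconst : ∀ x, gaussHazard (inner ℝ (w i) x) = gaussHazard (inner ℝ (w j) x) :=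
      fun x => by_contra fun h => hne ((hpt x).2 (hall x) i j h)
    -- Moving along `v`, the part of `w i` orthogonal to `w j`, fixes the hazard of `w j` while the
    -- argument for `w i` runs over all of `ℝ`; the hazard would be constant. Here `v ≠ 0`, since
    -- proportional vectors both pairing to `1` with `a` coincide.
    set v : W := w i - (inner ℝ (w i) (w j) : ℝ) • w j with hv
    have hvj : inner ℝ (w j) v = 0 := by
      rw [hv, inner_sub_right, inner_smul_right, real_inner_self_eq_norm_sq, hw j,
        real_inner_comm]
      ring
    have hvi : inner ℝ (w i) v ≠ 0 := by
      have : inner ℝ (w i) v = ‖v‖ ^ 2 := by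
        have h1 : w i = v + (inner ℝ (w i) (w j) : ℝ) • w j := by rw [hv]; abel
        conv_lhs => rw [h1]
        rw [inner_add_left, inner_smul_left, hvj, real_inner_self_eq_norm_sq]
        simp
      rw [this]
      refine pow_ne_zero 2 (norm_ne_zero_iff.2 fun h0 => hij ?_)
      have h1 := sub_eq_zero.1 h0
      have h2 := ha i
      rw [h1, inner_smul_right, ha j, mul_one] at h2
      rw [h1, h2, one_smul]
    refine not_forall_gaussHazard_eq (gaussHazard 0) fun s => ?_
    have := hconst ((s / inner ℝ (w i) v) • v)
    rwa [inner_smul_right, inner_smul_right, hvj, mul_zero, div_mul_cancel₀ _ hvi] at this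

end Transport

/-! ### The lift to `ℝ × ℝⁿ` and the weighted volume of cones. -/

/-- The volume of the regular `n`-simplex inscribed in the unit sphere of `ℝⁿ`. -/
noncomputable def regularSimplexVolume (n : ℕ) : ℝ :=
  ((n : ℝ) + 1) ^ (((n : ℝ) + 1) / 2) * (n : ℝ) ^ (-(n : ℝ) / 2) / (n.factorial : ℝ)

/-- The lift `u ↦ (1 / √(n + 1), √(n / (n + 1)) u)` of the unit sphere of `ℝⁿ` to a parallel of the
unit sphere of `ℝ × ℝⁿ`. -/
noncomputable def sphereLift {n : ℕ} (u : EuclideanSpace ℝ (Fin n)) :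
    WithLp 2 (ℝ × EuclideanSpace ℝ (Fin n)) :=
  WithLp.toLp 2 ((√((n : ℝ) + 1))⁻¹, (√(n : ℝ) * (√((n : ℝ) + 1))⁻¹) • u)

/-- The vertical vector `(√(n + 1), 0)`. -/
noncomputable def liftAxis (n : ℕ) : WithLp 2 (ℝ × EuclideanSpace ℝ (Fin n)) :=
  WithLp.toLp 2 (√((n : ℝ) + 1), 0)

/-- The cone `{(r, √n r y) | r > 0, y ∈ K}` over `K`. -/
def coneOver {n : ℕ} (K : Set (EuclideanSpace ℝ (Fin n))) :
    Set (WithLp 2 (ℝ × EuclideanSpace ℝ (Fin n))) :=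
  {x | 0 < x.fst ∧ (√(n : ℝ) * x.fst)⁻¹ • x.snd ∈ K}

section Lift
open Real Finset

variable {n : ℕ}

theorem regularSimplexVolume_pos (hn : 1 ≤ n) : 0 < regularSimplexVolume n := by
  have : (0 : ℝ) < n := by exact_mod_cast hn
  unfold regularSimplexVolume
  positivity

theorem inner_sphereLift (u v : EuclideanSpace ℝ (Fin n)) :
    inner ℝ (sphereLift u) (sphereLift v) = (1 + n * inner ℝ u v) / ((n : ℝ) + 1) := by
  have h1 : (0 : ℝ) < (n : ℝ) + 1 := by positivity
  rw [WithLp.prod_inner_apply]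
  simp only [sphereLift, inner_smul_left, inner_smul_right, conj_trivial, real_inner_eq_re_inner]
  simp only [RCLike.inner_apply, conj_trivial, RCLike.re_to_real]
  have h2 : (√((n : ℝ) + 1))⁻¹ * (√((n : ℝ) + 1))⁻¹ = ((n : ℝ) + 1)⁻¹ := by
    rw [← mul_inv, mul_self_sqrt h1.le]
  have h3 : √(n : ℝ) * √(n : ℝ) = n := mul_self_sqrt n.cast_nonneg
  calc _ = (√((n : ℝ) + 1))⁻¹ * (√((n : ℝ) + 1))⁻¹ * (1 + (√(n : ℝ) * √(n : ℝ)) * inner ℝ u v) := by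
        ring
    _ = _ := by rw [h2, h3]; field_simp

theorem norm_sphereLift {u : EuclideanSpace ℝ (Fin n)} (hu : ‖u‖ = 1) : ‖sphereLift u‖ = 1 := by
  have h : ‖sphereLift u‖ ^ 2 = 1 := by
    rw [← real_inner_self_eq_norm_sq, inner_sphereLift, real_inner_self_eq_norm_sq, hu]
    have h1 : (0 : ℝ) < (n : ℝ) + 1 := by positivity
    field_simp
    ring
  exact (pow_eq_one_iff_of_nonneg (norm_nonneg _) two_ne_zero).1 h

theorem inner_liftAxis_sphereLift (u : EuclideanSpace ℝ (Fin n)) :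
    inner ℝ (liftAxis n) (sphereLift u) = 1 := by
  have h1 : (0 : ℝ) < (n : ℝ) + 1 := by positivity
  rw [WithLp.prod_inner_apply]
  simp [liftAxis, sphereLift, (sqrt_pos.2 h1).ne']

theorem inner_liftAxis (x : WithLp 2 (ℝ × EuclideanSpace ℝ (Fin n))) :
    inner ℝ (liftAxis n) x = √((n : ℝ) + 1) * x.fst := by
  rw [WithLp.prod_inner_apply]
  simp [liftAxis, mul_comm]

theorem inner_sphereLift_left (u : EuclideanSpace ℝ (Fin n))
    (x : WithLp 2 (ℝ × EuclideanSpace ℝ (Fin n))) :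
    inner ℝ (sphereLift u) x =
      (√((n : ℝ) + 1))⁻¹ * (x.fst + √(n : ℝ) * inner ℝ u x.snd) := by
  rw [WithLp.prod_inner_apply]
  simp only [sphereLift, inner_smul_left, conj_trivial, RCLike.inner_apply, WithLp.ofLp_fst,
    WithLp.ofLp_snd]
  ring

theorem sum_smul_sphereLift_mem_coneOver {ι : Type*} [Fintype ι] [Nonempty ι] (hn : 1 ≤ n)
    {K : Set (EuclideanSpace ℝ (Fin n))} (hK : Convex ℝ K) {u : ι → EuclideanSpace ℝ (Fin n)}
    (hu : ∀ i, u i ∈ K) {θ : ι → ℝ} (hθ : ∀ i, 0 < θ i) :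
    ∑ i, θ i • sphereLift (u i) ∈ coneOver K := by
  have h1 : 0 < √((n : ℝ) + 1) := sqrt_pos.2 (by positivity)
  have h2 : 0 < √(n : ℝ) := sqrt_pos.2 (by exact_mod_cast hn)
  have hS : 0 < ∑ i, θ i := sum_pos (fun i _ => hθ i) univ_nonempty
  have hfst : (∑ i, θ i • sphereLift (u i)).fst = (∑ i, θ i) * (√((n : ℝ) + 1))⁻¹ := by
    rw [sum_mul]
    change WithLp.fstₗ 2 ℝ ℝ _ (∑ i, θ i • sphereLift (u i)) = _
    rw [map_sum]
    simp [sphereLift]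
  have hsnd : (∑ i, θ i • sphereLift (u i)).snd =
      (√(n : ℝ) * (√((n : ℝ) + 1))⁻¹) • ∑ i, θ i • u i := by
    rw [smul_sum]
    change WithLp.sndₗ 2 ℝ ℝ _ (∑ i, θ i • sphereLift (u i)) = _
    rw [map_sum]
    refine sum_congr rfl fun i _ => ?_
    simp [sphereLift, smul_smul, mul_comm]
  refine ⟨by rw [hfst]; positivity, ?_⟩
  rw [hfst, hsnd, smul_smul]
  have : (√(n : ℝ) * ((∑ i, θ i) * (√((n : ℝ) + 1))⁻¹))⁻¹ * (√(n : ℝ) * (√((n : ℝ) + 1))⁻¹) =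
      (∑ i, θ i)⁻¹ := by
    field_simp
  rw [this, smul_sum]
  simp_rw [smul_smul]
  refine hK.sum_mem (fun i _ => by have := hθ i; positivity) ?_ fun i _ => hu i
  rw [← mul_sum, inv_mul_cancel₀ hS.ne']

theorem lintegral_pow_mul_exp (n : ℕ) {b : ℝ} (hb : 0 < b) :
    ∫⁻ r in Set.Ioi (0 : ℝ), ENNReal.ofReal (r ^ n * exp (-(b * r))) =
      ENNReal.ofReal ((1 / b) ^ (n + 1) * n.factorial) := by
  have h := integral_rpow_mul_exp_neg_mul_Ioi (a := n + 1) (by positivity) hb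
  rw [Gamma_nat_eq_factorial] at h
  simp only [add_sub_cancel_right, rpow_natCast] at h
  have h' : (1 / b) ^ ((n : ℝ) + 1) = (1 / b) ^ (n + 1) := by
    rw [← rpow_natCast]; push_cast; rfl
  rw [h'] at h
  rw [← h, ofReal_integral_eq_lintegral_ofReal]
  · by_contra hni
    rw [integral_undef hni] at h
    have : 0 < (1 / b) ^ (n + 1) * (n.factorial : ℝ) := by positivity
    exact this.ne h
  · filter_upwards [ae_restrict_mem measurableSet_Ioi] with r hr
    have : (0 : ℝ) < r := hr
    positivity

theorem regularSimplexVolume_inv (hn : 1 ≤ n) :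
    √(n : ℝ) ^ n * ((1 / √((n : ℝ) + 1)) ^ (n + 1) * n.factorial) =
      (regularSimplexVolume n)⁻¹ := by
  have h0 : (0 : ℝ) < n := by exact_mod_cast hn
  have h1 : (0 : ℝ) < (n : ℝ) + 1 := by positivity
  have e1 : √(n : ℝ) ^ n = (n : ℝ) ^ ((n : ℝ) / 2) := by
    rw [sqrt_eq_rpow, ← rpow_natCast, ← rpow_mul h0.le]; ring_nf
  have e2 : (√((n : ℝ) + 1)) ^ (n + 1) = ((n : ℝ) + 1) ^ (((n : ℝ) + 1) / 2) := by
    rw [sqrt_eq_rpow, ← rpow_natCast, ← rpow_mul h1.le]; push_cast; ring_nf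
  unfold regularSimplexVolume
  rw [e1, div_pow, one_pow, e2, neg_div, rpow_neg h0.le]
  have := rpow_pos_of_pos h0 ((n : ℝ) / 2)
  have := rpow_pos_of_pos h1 (((n : ℝ) + 1) / 2)
  have : (0 : ℝ) < n.factorial := by positivity
  field_simp

theorem measurableSet_coneOver {K : Set (EuclideanSpace ℝ (Fin n))} (hK : MeasurableSet K) :
    MeasurableSet (coneOver K) := by
  have hf : Measurable fun x : WithLp 2 (ℝ × EuclideanSpace ℝ (Fin n)) => x.fst :=
    (by fun_prop : Continuous fun x : WithLp 2 (ℝ × EuclideanSpace ℝ (Fin n)) => x.fst).measurable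
  have hs : Measurable fun x : WithLp 2 (ℝ × EuclideanSpace ℝ (Fin n)) => x.snd :=
    (by fun_prop : Continuous fun x : WithLp 2 (ℝ × EuclideanSpace ℝ (Fin n)) => x.snd).measurable
  exact (measurableSet_lt measurable_const hf).inter (((hf.const_mul _).inv.smul hs) hK)

/-- The weighted volume of the cone over `K` in terms of the volume of `K`. -/
theorem lintegral_coneOver (hn : 1 ≤ n) {K : Set (EuclideanSpace ℝ (Fin n))}
    (hK : MeasurableSet K) :
    ∫⁻ x in coneOver K, ENNReal.ofReal (exp (-inner ℝ (liftAxis n) x)) =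
      volume K * ENNReal.ofReal (regularSimplexVolume n)⁻¹ := by
  have hb : 0 < √((n : ℝ) + 1) := sqrt_pos.2 (by positivity)
  have hq : 0 < √(n : ℝ) := sqrt_pos.2 (by exact_mod_cast hn)
  have hmp := WithLp.volume_preserving_toLp ℝ (EuclideanSpace ℝ (Fin n))
  have hC := measurableSet_coneOver hK
  have hC' := hmp.measurable hC
  have hF : Measurable fun x : WithLp 2 (ℝ × EuclideanSpace ℝ (Fin n)) =>
      ENNReal.ofReal (exp (-inner ℝ (liftAxis n) x)) := by fun_prop
  have hF' : Measurable fun p : ℝ × EuclideanSpace ℝ (Fin n) =>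
      ENNReal.ofReal (exp (-inner ℝ (liftAxis n) (WithLp.toLp 2 p))) := hF.comp hmp.measurable
  rw [← hmp.setLIntegral_comp_preimage hC hF, ← lintegral_indicator hC',
    Measure.volume_eq_prod, lintegral_prod _ (hF'.indicator hC').aemeasurable]
  -- The slice at height `r` is `√n r K`, which contributes the factor `√n ^ n * r ^ n`; the
  -- remaining integral in `r` is a Gamma integral.
  have hinner : ∀ r : ℝ, ∫⁻ y, (WithLp.toLp 2 ⁻¹' coneOver K).indicator
      (fun p : ℝ × EuclideanSpace ℝ (Fin n) =>
        ENNReal.ofReal (exp (-inner ℝ (liftAxis n) (WithLp.toLp 2 p)))) (r, y) =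
      (Set.Ioi (0 : ℝ)).indicator (fun r => volume K * (ENNReal.ofReal (√(n : ℝ) ^ n) *
        ENNReal.ofReal (r ^ n * exp (-(√((n : ℝ) + 1) * r))))) r := by
    intro r
    by_cases hr : 0 < r
    · rw [Set.indicator_of_mem (Set.mem_Ioi.2 hr)]
      have : ∀ y, (WithLp.toLp 2 ⁻¹' coneOver K).indicator
          (fun p : ℝ × EuclideanSpace ℝ (Fin n) =>
            ENNReal.ofReal (exp (-inner ℝ (liftAxis n) (WithLp.toLp 2 p)))) (r, y) =
          (((√(n : ℝ) * r)⁻¹ • ·) ⁻¹' K).indicator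
            (fun _ => ENNReal.ofReal (exp (-(√((n : ℝ) + 1) * r)))) y := by
        intro y
        by_cases hy : (√(n : ℝ) * r)⁻¹ • y ∈ K
        · rw [Set.indicator_of_mem (show y ∈ ((√(n : ℝ) * r)⁻¹ • ·) ⁻¹' K from hy),
            Set.indicator_of_mem (show (r, y) ∈ WithLp.toLp 2 ⁻¹' coneOver K from ⟨hr, hy⟩),
            inner_liftAxis]
          rfl
        · rw [Set.indicator_of_notMem (show y ∉ ((√(n : ℝ) * r)⁻¹ • ·) ⁻¹' K from hy),
            Set.indicator_of_notMem
              (show (r, y) ∉ WithLp.toLp 2 ⁻¹' coneOver K from fun h => hy h.2)]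
      simp_rw [this]
      have hpos : 0 < √(n : ℝ) * r := by positivity
      rw [lintegral_indicator_const ((measurable_const_smul _) hK),
        Measure.addHaar_preimage_smul _ (inv_ne_zero hpos.ne'), finrank_euclideanSpace_fin,
        inv_pow, inv_inv, abs_of_pos (by positivity), mul_pow,
        ENNReal.ofReal_mul (by positivity), ENNReal.ofReal_mul (by positivity)]
      ring
    · rw [Set.indicator_of_notMem (by simpa using hr)]
      have : ∀ y, (WithLp.toLp 2 ⁻¹' coneOver K).indicator
          (fun p : ℝ × EuclideanSpace ℝ (Fin n) =>
            ENNReal.ofReal (exp (-inner ℝ (liftAxis n) (WithLp.toLp 2 p)))) (r, y) = 0 :=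
        fun y => Set.indicator_of_notMem (fun h => hr h.1) _
      simp_rw [this, lintegral_zero]
  have hmeas : Measurable fun r : ℝ =>
      ENNReal.ofReal (r ^ n * exp (-(√((n : ℝ) + 1) * r))) := by fun_prop
  rw [lintegral_congr hinner, lintegral_indicator measurableSet_Ioi,
    lintegral_const_mul _ (hmeas.const_mul _), lintegral_const_mul _ hmeas,
    lintegral_pow_mul_exp n hb, ← ENNReal.ofReal_mul (by positivity), regularSimplexVolume_inv hn]

end Lift

/-! ### Compactness and volume of convex hulls. -/

section ConvexHull
open Finset

/-- In a finite-dimensional space the convex hull of a compact set is compact. -/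
theorem IsCompact.convexHull_of_finiteDimensional {V : Type*} [NormedAddCommGroup V]
    [NormedSpace ℝ V] [FiniteDimensional ℝ V] {s : Set V} (hs : IsCompact s) :
    IsCompact (convexHull ℝ s) := by
  rcases s.eq_empty_or_nonempty with rfl | ⟨v₀, hv₀⟩
  · simp
  set κ := Fin (Module.finrank ℝ V + 1)
  have himage : convexHull ℝ s = (fun p : (κ → ℝ) × (κ → V) => ∑ k, p.1 k • p.2 k) ''
      (stdSimplex ℝ κ ×ˢ Set.univ.pi fun _ => s) := by
    apply Set.Subset.antisymm
    · intro x hx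
      obtain ⟨ι, _, z, p, hz, hind, hp, hp1, hx⟩ := eq_pos_convex_span_of_mem_convexHull hx
      have hcard : Fintype.card ι ≤ Fintype.card κ := by
        rw [Fintype.card_fin]
        exact hind.card_le_finrank_succ.trans (Nat.succ_le_succ (Submodule.finrank_le _))
      obtain ⟨e⟩ := Function.Embedding.nonempty_of_card_le hcard
      have hout : ∀ k, k ∉ Set.range e → Function.extend e p 0 k = 0 := fun k hk => by
        rw [Function.extend_apply' _ _ _ (by simpa using hk)]; rfl
      -- The Carathéodory combination is padded to exactly `finrank + 1` points with weight `0`;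
      -- `v₀` only keeps the extra points in `s`.
      refine ⟨(Function.extend e p 0, Function.extend e z fun _ => v₀), ⟨⟨fun k => ?_, ?_⟩, ?_⟩, ?_⟩
      · by_cases hk : k ∈ Set.range e
        · obtain ⟨i, rfl⟩ := hk
          simpa [e.injective.extend_apply] using (hp i).le
        · exact (hout k hk).ge
      · rw [← hp1]
        exact (Fintype.sum_of_injective e e.injective _ _ hout fun i => by
          simp [e.injective.extend_apply]).symm
      · rintro k -
        by_cases hk : k ∈ Set.range e
        · obtain ⟨i, rfl⟩ := hk
          simpa [e.injective.extend_apply] using hz ⟨i, rfl⟩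
        · simpa [Function.extend_apply' _ _ _ (by simpa using hk : ¬∃ a, e a = k)] using hv₀
      · rw [← hx]
        exact (Fintype.sum_of_injective e e.injective _ _
          (fun k hk => by simp [hout k hk]) fun i => by
          simp [e.injective.extend_apply]).symm
    · rintro _ ⟨⟨p, z⟩, ⟨⟨hp, hp1⟩, hz⟩, rfl⟩
      exact (convex_convexHull ℝ s).sum_mem (fun k _ => hp k) hp1 fun k _ =>
        subset_convexHull ℝ s (hz k (Set.mem_univ k))
  rw [himage]
  refine ((isCompact_stdSimplex ℝ κ).prod (isCompact_univ_pi fun _ => hs)).image ?_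
  fun_prop

/-- Two compact convex sets of equal volume, one containing the other, agree as soon as the volume
is positive. -/
theorem eq_of_subset_of_volume_eq {E : Type*} [NormedAddCommGroup E] [NormedSpace ℝ E]
    [FiniteDimensional ℝ E] [MeasurableSpace E] [BorelSpace E] {μ : Measure E}
    [μ.IsAddHaarMeasure] {K L : Set E} (hK : IsCompact K) (hKc : Convex ℝ K) (hL : Convex ℝ L)
    (hsub : K ⊆ L) (hvol : μ L = μ K) (hpos : 0 < μ K) : K = L := by
  have hint : (interior K).Nonempty := by
    by_contra h
    rw [Set.not_nonempty_iff_eq_empty] at h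
    have h0 := hKc.addHaar_frontier μ
    rw [hK.isClosed.frontier_eq, h, Set.sdiff_empty] at h0
    exact hpos.ne' h0
  refine hsub.antisymm fun x hx => by_contra fun hxK => ?_
  -- A convex set with nonempty interior lies in the closure of that interior. A point of `L`
  -- outside the closed set `K` thus yields a nonempty open subset of `L` missing `K`, of positive
  -- measure.
  have hcl : x ∈ closure (interior L) := by
    rw [hL.closure_interior_eq_closure_of_nonempty_interior (hint.mono (interior_mono hsub))]
    exact subset_closure hx
  obtain ⟨y, hyK, hyL⟩ := mem_closure_iff.1 hcl Kᶜ hK.isClosed.isOpen_compl hxK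
  have hU : IsOpen (Kᶜ ∩ interior L) := hK.isClosed.isOpen_compl.inter isOpen_interior
  have h1 : 0 < μ (Kᶜ ∩ interior L) := hU.measure_pos μ ⟨y, hyK, hyL⟩
  have h2 : μ K + μ (Kᶜ ∩ interior L) ≤ μ L := by
    rw [← measure_union (Set.disjoint_left.2 fun z hz hz' => hz'.1 hz) hU.measurableSet]
    exact measure_mono (Set.union_subset hsub fun z hz => interior_subset hz.2)
  rw [hvol] at h2
  exact (ENNReal.lt_add_right hK.measure_lt_top.ne h1.ne').not_ge h2

end ConvexHull

/-! ### From isotropic measures to finite decompositions of the identity. -/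

section Isotropic
open Real Finset

variable {n : ℕ} {Z : Measure (Metric.sphere (0 : EuclideanSpace ℝ (Fin n)) 1)}

theorem supportBody_eq : supportBody Z = convexHull ℝ (Subtype.val '' Z.support) := by
  rw [supportBody, Set.image_id']

theorem isCompact_support_image :
    IsCompact (Subtype.val '' Z.support : Set (EuclideanSpace ℝ (Fin n))) :=
  Z.isClosed_support.isCompact.image continuous_subtype_val

theorem continuous_sphereLift : Continuous (sphereLift (n := n)) := by
  unfold sphereLift
  fun_prop

theorem integrable_of_continuous_sphere [IsFiniteMeasure Z] {F : Type*} [NormedAddCommGroup F]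
    {f : Metric.sphere (0 : EuclideanSpace ℝ (Fin n)) 1 → F} (hf : Continuous f) :
    Integrable f Z :=
  hf.integrable_of_hasCompactSupport (HasCompactSupport.of_compactSpace f)

/-- Take the trace: sum the isotropy identity over the standard basis. -/
theorem measureReal_univ_of_isotropic (hZ : IsIsotropic Z) : Z.real Set.univ = n := by
  have := hZ.isFiniteMeasure
  have h : ∑ k : Fin n, ‖EuclideanSpace.single k (1 : ℝ)‖ ^ 2 = ∫ _u, (1 : ℝ) ∂Z := by
    simp_rw [hZ.norm_sq_eq]
    rw [← integral_finsetSum]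
    · refine integral_congr_ae (ae_of_all _ fun u => ?_)
      have hu : ‖(u : EuclideanSpace ℝ (Fin n))‖ ^ 2 = 1 := by
        rw [mem_sphere_zero_iff_norm.1 u.2, one_pow]
      rw [EuclideanSpace.norm_sq_eq] at hu
      simpa [EuclideanSpace.inner_single_left] using hu
    · exact fun k _ => integrable_of_continuous_sphere (by fun_prop)
  simpa using h.symm

theorem integral_coe_eq_zero (hn : 1 ≤ n) (hZ : IsIsotropic Z) (hc : sphereCentroid Z = 0) :
    ∫ u, (u : EuclideanSpace ℝ (Fin n)) ∂Z = 0 := by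
  have h0 : (n : ℝ) ≠ 0 := by exact_mod_cast (by omega : n ≠ 0)
  rw [sphereCentroid, measureReal_univ_of_isotropic hZ] at hc
  exact (smul_eq_zero.1 hc).resolve_left (one_div_ne_zero h0)

/-- On expanding the square, the cross term vanishes by centring, the vertical term gets the mass
`n`, and the factor `√n` in the lift gives the horizontal term the same weight. -/
theorem integral_inner_sphereLift_sq (hn : 1 ≤ n) (hZ : IsIsotropic Z)
    (hc : sphereCentroid Z = 0) (x : WithLp 2 (ℝ × EuclideanSpace ℝ (Fin n))) :
    ∫ u, inner ℝ (sphereLift (u : EuclideanSpace ℝ (Fin n))) x ^ 2 ∂Z =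
      n / ((n : ℝ) + 1) * ‖x‖ ^ 2 := by
  have := hZ.isFiniteMeasure
  have h1 : (0 : ℝ) < (n : ℝ) + 1 := by positivity
  have hsq : (√((n : ℝ) + 1))⁻¹ ^ 2 = ((n : ℝ) + 1)⁻¹ := by rw [inv_pow, sq_sqrt h1.le]
  have hpt : ∀ u : Metric.sphere (0 : EuclideanSpace ℝ (Fin n)) 1,
      inner ℝ (sphereLift (u : EuclideanSpace ℝ (Fin n))) x ^ 2 =
      ((n : ℝ) + 1)⁻¹ * (x.fst ^ 2 +
        (2 * x.fst * √(n : ℝ)) * inner ℝ x.snd (u : EuclideanSpace ℝ (Fin n)) +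
        n * |inner ℝ x.snd (u : EuclideanSpace ℝ (Fin n))| ^ 2) := by
    intro u
    rw [inner_sphereLift_left, mul_pow, hsq, sq_abs, real_inner_comm, add_sq, mul_pow,
      sq_sqrt n.cast_nonneg]
    ring
  simp_rw [hpt]
  have i1 : Integrable (fun u : Metric.sphere (0 : EuclideanSpace ℝ (Fin n)) 1 =>
      (2 * x.fst * √(n : ℝ)) * inner ℝ x.snd (u : EuclideanSpace ℝ (Fin n))) Z :=
    integrable_of_continuous_sphere (by fun_prop)
  have i2 : Integrable (fun u : Metric.sphere (0 : EuclideanSpace ℝ (Fin n)) 1 =>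
      n * |inner ℝ x.snd (u : EuclideanSpace ℝ (Fin n))| ^ 2) Z :=
    integrable_of_continuous_sphere (by fun_prop)
  have h3 : ∫ u : Metric.sphere (0 : EuclideanSpace ℝ (Fin n)) 1,
      inner ℝ x.snd (u : EuclideanSpace ℝ (Fin n)) ∂Z = 0 := by
    rw [integral_inner (integrable_of_continuous_sphere (by fun_prop)),
      integral_coe_eq_zero hn hZ hc, inner_zero_right]
  have i0 : Integrable (fun u : Metric.sphere (0 : EuclideanSpace ℝ (Fin n)) 1 =>
      x.fst ^ 2 + (2 * x.fst * √(n : ℝ)) * inner ℝ x.snd (u : EuclideanSpace ℝ (Fin n))) Z :=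
    integrable_of_continuous_sphere (by fun_prop)
  rw [integral_const_mul, integral_add i0 i2, integral_add (integrable_const _) i1,
    integral_const, integral_const_mul, integral_const_mul,
    h3, ← hZ.norm_sq_eq, measureReal_univ_of_isotropic hZ, WithLp.prod_norm_sq_eq_of_L2]
  simp only [smul_eq_mul, norm_eq_abs, sq_abs]
  field_simp
  ring

/-- An isotropic centred measure can be replaced by a finitely supported one, given here by its
lifted decomposition of the identity. -/
theorem exists_finite_frame (hn : 1 ≤ n) (hZ : IsIsotropic Z) (hc : sphereCentroid Z = 0) :
    ∃ (ι : Type) (_ : Fintype ι) (u : ι → EuclideanSpace ℝ (Fin n)) (c : ι → ℝ),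
      (∀ i, u i ∈ (Subtype.val '' Z.support : Set (EuclideanSpace ℝ (Fin n)))) ∧
      Function.Injective u ∧ (∀ i, 0 < c i) ∧ ∑ i, c i = n + 1 ∧
      ∀ x, ∑ i, c i * inner ℝ (sphereLift (u i)) x ^ 2 = ‖x‖ ^ 2 := by
  have := hZ.isFiniteMeasure
  have h0 : (n : ℝ) ≠ 0 := by exact_mod_cast (by omega : n ≠ 0)
  have h1 : (0 : ℝ) < (n : ℝ) + 1 := by positivity
  have hmass := measureReal_univ_of_isotropic hZ
  have : NeZero Z := ⟨fun h => h0 (by rw [← hmass, h]; simp)⟩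
  set G : EuclideanSpace ℝ (Fin n) → (WithLp 2 (ℝ × EuclideanSpace ℝ (Fin n)) →L[ℝ]
      WithLp 2 (ℝ × EuclideanSpace ℝ (Fin n))) :=
    fun u => InnerProductSpace.rankOne ℝ (sphereLift u) (sphereLift u) with hG
  have hGc : Continuous G := by
    have := continuous_sphereLift (n := n)
    exact ((InnerProductSpace.rankOne ℝ).continuous.comp this).clm_apply this
  set S : Set (EuclideanSpace ℝ (Fin n)) := Subtype.val '' Z.support with hS
  have hGi : Integrable (fun u : Metric.sphere (0 : EuclideanSpace ℝ (Fin n)) 1 =>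
      G (u : EuclideanSpace ℝ (Fin n))) Z :=
    integrable_of_continuous_sphere (hGc.comp continuous_subtype_val)
  -- The mean of `w ⊗ w` lies in the convex hull of its values on the support, which is closed
  -- because it is compact.
  have hmem := (convex_convexHull ℝ (G '' S)).average_mem (μ := Z)
    (isCompact_support_image.image hGc).convexHull_of_finiteDimensional.isClosed
    (Filter.mem_of_superset Z.support_mem_ae fun u hu =>
      subset_convexHull ℝ _ ⟨_, ⟨u, hu, rfl⟩, rfl⟩) hGi
  obtain ⟨ι, _, z, p, hz, hind, hp, hp1, hx⟩ := eq_pos_convex_span_of_mem_convexHull hmem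
  choose u huS huz using fun i => hz ⟨i, rfl⟩
  -- The mean operator is `(n + 1)⁻¹ • id`, hence the rescaling by `n + 1`. Affine independence of
  -- the operators makes the chosen points distinct.
  refine ⟨ι, _, u, fun i => (n + 1) * p i, huS, fun i j hij => hind.injective ?_, fun i =>
    mul_pos h1 (hp i), by rw [← mul_sum, hp1, mul_one], fun x => ?_⟩
  · rw [← huz, ← huz, hij]
  · have h2 := congrArg (fun T : WithLp 2 (ℝ × EuclideanSpace ℝ (Fin n)) →L[ℝ]
      WithLp 2 (ℝ × EuclideanSpace ℝ (Fin n)) => inner ℝ x (T x)) hx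
    simp only [average_eq, hmass, _root_.sum_apply, _root_.smul_apply, inner_sum,
      inner_smul_right] at h2
    rw [ContinuousLinearMap.integral_apply hGi, ← integral_inner
      (integrable_of_continuous_sphere (by
        have := hGc.comp (continuous_subtype_val
          (p := fun v => v ∈ Metric.sphere (0 : EuclideanSpace ℝ (Fin n)) 1))
        exact this.clm_apply continuous_const))] at h2
    have h3 : ∀ v, inner ℝ x (G v x) = inner ℝ (sphereLift v) x ^ 2 := fun v => by
      simp only [hG, InnerProductSpace.rankOne_apply, inner_smul_right]
      rw [real_inner_comm (sphereLift v) x, sq]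
    simp_rw [h3, integral_inner_sphereLift_sq hn hZ hc, ← huz, h3] at h2
    simp_rw [mul_assoc, ← mul_sum, h2]
    field_simp

end Isotropic

/-! ### Regular simplices and orthonormal lifts. -/

section RegularSimplex
open Real Finset

variable {n : ℕ}

theorem finrank_withLp_prod :
    Module.finrank ℝ (WithLp 2 (ℝ × EuclideanSpace ℝ (Fin n))) = n + 1 := by
  rw [(WithLp.linearEquiv 2 ℝ (ℝ × EuclideanSpace ℝ (Fin n))).finrank_eq, Module.finrank_prod,
    finrank_euclideanSpace_fin, Module.finrank_self, add_comm]

/-- The orthonormal basis of `ℝ × ℝⁿ` given by an orthonormal family of lifted points. -/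
noncomputable def liftBasis {p : Fin (n + 1) → EuclideanSpace ℝ (Fin n)}
    (hp : Orthonormal ℝ fun i => sphereLift (p i)) :
    OrthonormalBasis (Fin (n + 1)) ℝ (WithLp 2 (ℝ × EuclideanSpace ℝ (Fin n))) :=
  (basisOfOrthonormalOfCardEqFinrank hp (by simp [finrank_withLp_prod])).toOrthonormalBasis
    (by simpa using hp)

theorem liftBasis_apply {p : Fin (n + 1) → EuclideanSpace ℝ (Fin n)}
    (hp : Orthonormal ℝ fun i => sphereLift (p i)) (i : Fin (n + 1)) :
    liftBasis hp i = sphereLift (p i) := by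
  simp [liftBasis]

theorem sum_liftBasis {p : Fin (n + 1) → EuclideanSpace ℝ (Fin n)}
    (hp : Orthonormal ℝ fun i => sphereLift (p i)) : ∑ i, liftBasis hp i = liftAxis n := by
  rw [← (liftBasis hp).sum_repr' (liftAxis n)]
  refine sum_congr rfl fun i _ => ?_
  rw [real_inner_comm, liftBasis_apply, inner_liftAxis_sphereLift, one_smul]

/-- An affine relation among the points, with coefficients summing to zero, is a linear relation
among their lifts. -/
theorem affineIndependent_of_orthonormal_sphereLift
    {p : Fin (n + 1) → EuclideanSpace ℝ (Fin n)}
    (hp : Orthonormal ℝ fun i => sphereLift (p i)) : AffineIndependent ℝ p := by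
  rw [affineIndependent_iff]
  intro s g hg0 hgp i hi
  refine linearIndependent_iff'.1 hp.linearIndependent s g ?_ i hi
  refine InnerProductSpace.ext_inner_left_basis (𝕜 := ℝ) (liftBasis hp).toBasis fun j => ?_
  rw [OrthonormalBasis.coe_toBasis, liftBasis_apply, inner_zero_right, inner_sum]
  simp_rw [inner_smul_right, inner_sphereLift]
  have h1 : ∑ k ∈ s, g k * ((1 + n * inner ℝ (p j) (p k)) / ((n : ℝ) + 1)) =
      (∑ k ∈ s, g k + n * inner ℝ (p j) (∑ k ∈ s, g k • p k)) / ((n : ℝ) + 1) := by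
    rw [inner_sum, mul_sum, ← sum_add_distrib, sum_div]
    refine sum_congr rfl fun k _ => ?_
    rw [inner_smul_right]
    ring
  rw [h1, hg0, hgp, inner_zero_right]
  simp

/-- Points of the sphere with orthonormal lifts are permuted arbitrarily by linear isometries. -/
theorem exists_isometry_of_orthonormal_sphereLift (hn : 1 ≤ n)
    {p : Fin (n + 1) → EuclideanSpace ℝ (Fin n)}
    (hp : Orthonormal ℝ fun i => sphereLift (p i)) (σ : Equiv.Perm (Fin (n + 1))) :
    ∃ x : EuclideanSpace ℝ (Fin n) ≃ᵢ EuclideanSpace ℝ (Fin n), p ∘ σ = x ∘ p := by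
  -- Permuting the orthonormal basis fixes its sum, the axis, so `U` restricts to an isometry of the
  -- horizontal copy of `ℝⁿ`.
  set U := (liftBasis hp).equiv (liftBasis hp) σ with hU
  have hUp : ∀ i, U (sphereLift (p i)) = sphereLift (p (σ i)) := fun i => by
    rw [← liftBasis_apply hp, ← liftBasis_apply hp, hU, OrthonormalBasis.equiv_apply_basis]
  have hUa : U (liftAxis n) = liftAxis n := by
    rw [← sum_liftBasis hp, map_sum, ← Equiv.sum_comp σ (liftBasis hp)]
    exact sum_congr rfl fun i _ => by rw [liftBasis_apply, hUp, liftBasis_apply]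
  have hb : 0 < √((n : ℝ) + 1) := sqrt_pos.2 (by positivity)
  have hq : 0 < √(n : ℝ) := sqrt_pos.2 (by exact_mod_cast hn)
  set T : EuclideanSpace ℝ (Fin n) →ₗ[ℝ] EuclideanSpace ℝ (Fin n) :=
    WithLp.sndₗ 2 ℝ ℝ (EuclideanSpace ℝ (Fin n)) ∘ₗ U.toLinearEquiv.toLinearMap ∘ₗ
      (WithLp.linearEquiv 2 ℝ (ℝ × EuclideanSpace ℝ (Fin n))).symm.toLinearMap ∘ₗ
      LinearMap.inr ℝ ℝ (EuclideanSpace ℝ (Fin n)) with hT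
  have hTy : ∀ y, T y = (U (WithLp.toLp 2 (0, y))).snd := fun y => rfl
  have hfst : ∀ y, (U (WithLp.toLp 2 (0, y))).fst = 0 := fun y => by
    have h1 := inner_liftAxis (U (WithLp.toLp 2 (0, y)))
    rw [← hUa, U.inner_map_map, inner_liftAxis] at h1
    simpa [hb.ne'] using h1.symm
  have hnorm : ∀ y, ‖T y‖ = ‖y‖ := fun y => by
    have h1 := WithLp.prod_norm_sq_eq_of_L2 (U (WithLp.toLp 2 (0, y)))
    rw [hfst, U.norm_map, WithLp.prod_norm_sq_eq_of_L2] at h1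
    simp only [WithLp.toLp_fst, WithLp.toLp_snd, norm_zero, ne_eq, OfNat.ofNat_ne_zero,
      not_false_eq_true, zero_pow, zero_add] at h1
    rw [hTy]
    exact ((sq_eq_sq₀ (norm_nonneg _) (norm_nonneg _)).1 h1).symm
  refine ⟨((⟨T, hnorm⟩ : EuclideanSpace ℝ (Fin n) →ₗᵢ[ℝ] EuclideanSpace ℝ (Fin n)
    ).toLinearIsometryEquiv rfl).toIsometryEquiv, funext fun i => ?_⟩
  change p (σ i) = T (p i)
  have hdec : sphereLift (p i) = ((n : ℝ) + 1)⁻¹ • liftAxis n +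
      (√(n : ℝ) * (√((n : ℝ) + 1))⁻¹) • WithLp.toLp 2 ((0 : ℝ), p i) := by
    refine (WithLp.linearEquiv 2 ℝ (ℝ × EuclideanSpace ℝ (Fin n))).injective (Prod.ext ?_ ?_)
    · have : √((n : ℝ) + 1) * √((n : ℝ) + 1) = (n : ℝ) + 1 := mul_self_sqrt (by positivity)
      simp [sphereLift, liftAxis]
      field_simp
      linarith
    · simp [sphereLift, liftAxis]
  have h2 := congrArg (WithLp.sndₗ 2 ℝ ℝ (EuclideanSpace ℝ (Fin n))) (hUp i)
  rw [hdec, map_add, map_smul, map_smul, hUa, map_add, map_smul, map_smul] at h2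
  simp only [WithLp.sndₗ_apply, ← hTy] at h2
  simp only [liftAxis, sphereLift, WithLp.toLp_snd, smul_zero, zero_add] at h2
  exact (smul_right_injective _ (by positivity :
    √(n : ℝ) * (√((n : ℝ) + 1))⁻¹ ≠ 0) h2).symm

theorem isInscribedRegularSimplex_convexHull (hn : 1 ≤ n)
    {p : Fin (n + 1) → EuclideanSpace ℝ (Fin n)} (hp1 : ∀ i, ‖p i‖ = 1)
    (hp : Orthonormal ℝ fun i => sphereLift (p i)) :
    IsInscribedRegularSimplex (convexHull ℝ (Set.range p)) :=
  ⟨⟨p, affineIndependent_of_orthonormal_sphereLift hp⟩,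
    exists_isometry_of_orthonormal_sphereLift hn hp,
    fun i => mem_sphere_zero_iff_norm.2 (hp1 i), rfl⟩

/-- The vertices of a regular simplex inscribed in the unit sphere have orthonormal lifts. -/
theorem orthonormal_sphereLift_of_regular (hn : 1 ≤ n)
    {s : Affine.Simplex ℝ (EuclideanSpace ℝ (Fin n)) n} (hs : s.Regular)
    (h1 : ∀ i, ‖s.points i‖ = 1) : Orthonormal ℝ fun i => sphereLift (s.points i) := by
  obtain ⟨r, hr⟩ := hs.equilateral
  have hn0 : (0 : ℝ) < n := by exact_mod_cast hn
  set ρ := 1 - r ^ 2 / 2 with hρ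
  have hin : ∀ i j, i ≠ j → inner ℝ (s.points i) (s.points j) = ρ := fun i j hij => by
    have h2 := norm_sub_sq_real (s.points i) (s.points j)
    rw [← dist_eq_norm, hr i j hij, h1, h1] at h2
    rw [hρ]; linarith
  have hρ1 : ρ ≠ 1 := fun h => by
    have hne : (0 : Fin (n + 1)) ≠ Fin.last n := by
      simp [Fin.ext_iff]; omega
    have h2 := hin 0 (Fin.last n) hne
    rw [h, inner_eq_one_iff_of_norm_eq_one (h1 _) (h1 _)] at h2
    exact hne (s.independent.injective h2)
  -- Pairing a nontrivial relation among these `n + 1` vectors of `ℝⁿ` with each vertex shows that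
  -- all coefficients are equal, whence `1 + n ρ = 0`: orthogonality of the lifts.
  have hdep : ¬ LinearIndependent ℝ s.points := fun h => by
    have := h.fintype_card_le_finrank
    simp at this
  obtain ⟨g, hg, i₀, hi₀⟩ := Fintype.not_linearIndependent_iff.1 hdep
  have hgj : ∀ j, g j * (1 - ρ) = -ρ * ∑ i, g i := fun j => by
    have h2 : inner ℝ (s.points j) (∑ i, g i • s.points i) = 0 := by rw [hg, inner_zero_right]
    rw [inner_sum] at h2
    have h3 : ∀ i, inner ℝ (s.points j) (g i • s.points i) =
        ρ * g i + if j = i then (1 - ρ) * g i else 0 := fun i => by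
      rw [inner_smul_right]
      split_ifs with h
      · rw [h, real_inner_self_eq_norm_sq, h1]; ring
      · rw [hin j i h]; ring
    simp_rw [h3, sum_add_distrib, ← mul_sum] at h2
    simp only [sum_ite_eq, mem_univ, if_true] at h2
    linarith
  have hρn : 1 + n * ρ = 0 := by
    have hconst : ∀ j, g j = g i₀ := fun j =>
      mul_right_cancel₀ (sub_ne_zero.2 hρ1.symm) ((hgj j).trans (hgj i₀).symm)
    have h2 := hgj i₀
    simp only [hconst, sum_const, card_univ, Fintype.card_fin, nsmul_eq_mul] at h2
    push_cast at h2
    have h3 : g i₀ * (1 + n * ρ) = 0 := by linear_combination h2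
    exact (mul_eq_zero.1 h3).resolve_left hi₀
  refine ⟨fun i => norm_sphereLift (h1 i), fun i j hij => ?_⟩
  change inner ℝ (sphereLift (s.points i)) (sphereLift (s.points j)) = 0
  rw [inner_sphereLift, hin i j hij, hρn, zero_div]

theorem integral_indicator_exp_neg :
    ∫ t : ℝ, (Set.Ici (0 : ℝ)).indicator (fun t => exp (-t)) t = 1 := by
  rw [integral_indicator measurableSet_Ici, integral_Ici_eq_integral_Ioi, integral_exp_neg_Ioi_zero]

/-- The integral of `exp (-∑ i, ⟪b i, x⟫)` over the orthant of an orthonormal basis `b`. -/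
theorem lintegral_orthant {W : Type*} [NormedAddCommGroup W] [InnerProductSpace ℝ W]
    [FiniteDimensional ℝ W] [MeasurableSpace W] [BorelSpace W] {ι : Type*} [Fintype ι]
    (b : OrthonormalBasis ι ℝ W) :
    ∫⁻ x in {x | ∀ i, 0 ≤ inner ℝ (b i) x}, ENNReal.ofReal (exp (-inner ℝ (∑ i, b i) x)) = 1 := by
  set f : ℝ → ℝ := (Set.Ici (0 : ℝ)).indicator fun t => exp (-t) with hf
  have hf0 : ∀ t, 0 ≤ f t := fun t => Set.indicator_nonneg (fun t _ => (exp_pos _).le) t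
  have hfm : Measurable f := (by fun_prop : Measurable fun t : ℝ => exp (-t)).indicator
    measurableSet_Ici
  have hset : MeasurableSet {x | ∀ i, 0 ≤ inner ℝ (b i) x} := by
    rw [Set.ofPred_forall]
    exact MeasurableSet.iInter fun i => measurableSet_le measurable_const (by fun_prop)
  have hmp := (PiLp.volume_preserving_ofLp ι).comp b.measurePreserving_repr
  have hpt : ∀ x, {x | ∀ i, 0 ≤ inner ℝ (b i) x}.indicator
      (fun x => ENNReal.ofReal (exp (-inner ℝ (∑ i, b i) x))) x =
      ENNReal.ofReal (∏ i, f ((WithLp.ofLp ∘ b.repr) x i)) := fun x => by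
    simp only [Function.comp_apply, b.repr_apply_apply]
    by_cases hx : ∀ i, 0 ≤ inner ℝ (b i) x
    · rw [Set.indicator_of_mem (show x ∈ {x | ∀ i, 0 ≤ inner ℝ (b i) x} from hx), sum_inner,
        ← sum_neg_distrib, exp_sum]
      congr 1
      refine prod_congr rfl fun i _ => ?_
      rw [hf, Set.indicator_of_mem (Set.mem_Ici.2 (hx i))]
    · rw [Set.indicator_of_notMem (show x ∉ {x | ∀ i, 0 ≤ inner ℝ (b i) x} from hx)]
      push Not at hx
      obtain ⟨i, hi⟩ := hx
      rw [prod_eq_zero (mem_univ i), ENNReal.ofReal_zero]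
      rw [hf, Set.indicator_of_notMem (by simpa using hi)]
  have hm : Measurable fun y : ι → ℝ => ENNReal.ofReal (∏ i, f (y i)) :=
    ENNReal.measurable_ofReal.comp
      (Finset.measurable_fun_prod _ fun i _ => hfm.comp (measurable_pi_apply i))
  have hint : ∫ y : ι → ℝ, ∏ i, f (y i) = 1 := by
    rw [integral_fintype_prod_volume_eq_pow, hf, integral_indicator_exp_neg, one_pow]
  rw [← lintegral_indicator hset, lintegral_congr hpt, hmp.lintegral_comp hm,
    ← ofReal_integral_eq_lintegral_ofReal _ (ae_of_all _ fun y => prod_nonneg fun i _ => hf0 _),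
    hint, ENNReal.ofReal_one]
  by_contra hni
  rw [integral_undef hni] at hint
  exact zero_ne_one hint

end RegularSimplex

/-! ### The inequality and its equality cases. -/

section Main
open Real Finset

variable {n : ℕ}

theorem le_volume_iff (hn : 1 ≤ n) {v : ENNReal} :
    ENNReal.ofReal (regularSimplexVolume n) ≤ v ↔
      1 ≤ v * ENNReal.ofReal (regularSimplexVolume n)⁻¹ := by
  have h := regularSimplexVolume_pos hn
  rw [ENNReal.ofReal_inv_of_pos h, ← div_eq_mul_inv, ENNReal.le_div_iff_mul_le
    (Or.inl (ENNReal.ofReal_pos.2 h).ne') (Or.inl ENNReal.ofReal_ne_top), one_mul]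

theorem volume_le_iff (hn : 1 ≤ n) {v : ENNReal} :
    v ≤ ENNReal.ofReal (regularSimplexVolume n) ↔
      v * ENNReal.ofReal (regularSimplexVolume n)⁻¹ ≤ 1 := by
  have h := regularSimplexVolume_pos hn
  rw [ENNReal.ofReal_inv_of_pos h, ← div_eq_mul_inv, ENNReal.div_le_iff_le_mul
    (Or.inl (ENNReal.ofReal_pos.2 h).ne') (Or.inl ENNReal.ofReal_ne_top), one_mul]

/-- The volume inequality for a finitely supported isotropic measure, with its equality case. -/
theorem le_volume_convexHull_range {ι : Type*} [Fintype ι] (hn : 1 ≤ n)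
    {u : ι → EuclideanSpace ℝ (Fin n)} {c : ι → ℝ} (hu : ∀ i, ‖u i‖ = 1)
    (huinj : Function.Injective u) (hc : ∀ i, 0 < c i) (hsum : ∑ i, c i = n + 1)
    (hI : ∀ x, ∑ i, c i * inner ℝ (sphereLift (u i)) x ^ 2 = ‖x‖ ^ 2) :
    ENNReal.ofReal (regularSimplexVolume n) ≤ volume (convexHull ℝ (Set.range u)) ∧
      (volume (convexHull ℝ (Set.range u)) = ENNReal.ofReal (regularSimplexVolume n) →
        IsInscribedRegularSimplex (convexHull ℝ (Set.range u))) := by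
  have h1 : (0 : ℝ) < (n : ℝ) + 1 := by positivity
  have : Nonempty ι := by
    by_contra h
    rw [not_nonempty_iff] at h
    rw [univ_eq_empty, sum_empty] at hsum
    exact h1.ne hsum
  have hK : IsCompact (convexHull ℝ (Set.range u)) := (Set.finite_range u).isCompact_convexHull ℝ
  have key := one_le_lintegral_cone hc (fun i => norm_sphereLift (hu i)) hI
    (fun i => inner_liftAxis_sphereLift (u i)) (C := coneOver (convexHull ℝ (Set.range u)))
    fun θ hθ => sum_smul_sphereLift_mem_coneOver hn (convex_convexHull ℝ _)
      (fun i => subset_convexHull ℝ _ (Set.mem_range_self i)) hθ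
  rw [lintegral_coneOver hn hK.measurableSet] at key
  refine ⟨(le_volume_iff hn).2 key.1, fun heq => ?_⟩
  have hpair := key.2 (le_antisymm ((volume_le_iff hn).1 heq.le) key.1)
  have horth : ∀ i j, i ≠ j → inner ℝ (sphereLift (u i)) (sphereLift (u j)) = 0 := by
    intro i j hij
    refine hpair i j fun h => hij (huinj ?_)
    have h2 := inner_sphereLift (u i) (u j)
    rw [← h, real_inner_self_eq_norm_sq, norm_sphereLift (hu i), eq_div_iff h1.ne'] at h2
    have h3 : (n : ℝ) * (inner ℝ (u i) (u j) - 1) = 0 := by linarith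
    have h4 : (n : ℝ) ≠ 0 := by exact_mod_cast (by omega : n ≠ 0)
    exact (inner_eq_one_iff_of_norm_eq_one (hu i) (hu j)).1
      (sub_eq_zero.1 ((mul_eq_zero.1 h3).resolve_left h4))
  -- Testing the decomposition of the identity on one of the orthonormal lifts isolates its weight;
  -- the total weight `n + 1` then counts the points.
  have hc1 : ∀ j, c j = 1 := fun j => by
    have h2 := hI (sphereLift (u j))
    rw [sum_eq_single j (fun i _ hij => by rw [horth i j hij]; ring) (by simp),
      real_inner_self_eq_norm_sq, norm_sphereLift (hu j)] at h2
    simpa using h2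
  have hcard : Fintype.card ι = n + 1 := by
    simp only [hc1, sum_const, card_univ, nsmul_eq_mul, mul_one] at hsum
    exact_mod_cast hsum
  let e := (Fintype.equivFinOfCardEq hcard).symm
  have hrange : Set.range u = Set.range (u ∘ e) := (e.surjective.range_comp u).symm
  rw [hrange]
  exact isInscribedRegularSimplex_convexHull hn (fun i => hu (e i))
    ⟨fun i => norm_sphereLift (hu (e i)), fun i j hij => horth _ _ (e.injective.ne hij)⟩

/-- The cone over the simplex lies in the orthant of the orthonormal lifts, whose sum is the axis,
so its weighted volume is at most `1`. -/
theorem volume_le_of_isInscribedRegularSimplex (hn : 1 ≤ n) {K : Set (EuclideanSpace ℝ (Fin n))}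
    (hK : IsInscribedRegularSimplex K) :
    volume K ≤ ENNReal.ofReal (regularSimplexVolume n) := by
  obtain ⟨s, hs, hmem, rfl⟩ := hK
  have hort := orthonormal_sphereLift_of_regular hn hs fun i => mem_sphere_zero_iff_norm.1 (hmem i)
  have hK : IsCompact (convexHull ℝ (Set.range s.points)) :=
    (Set.finite_range s.points).isCompact_convexHull ℝ
  rw [volume_le_iff hn, ← lintegral_coneOver hn hK.measurableSet, ← lintegral_orthant
    (liftBasis hort), sum_liftBasis]
  refine lintegral_mono_set fun x hx i => ?_
  obtain ⟨hx0, hxK⟩ := hx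
  have hq : 0 < √(n : ℝ) := sqrt_pos.2 (by exact_mod_cast hn)
  -- These half-spaces translate nonnegativity of the pairing with a lifted vertex; it suffices to
  -- check them at the vertices, where orthonormality applies.
  have hhalf : convexHull ℝ (Set.range s.points) ⊆ {y | -1 ≤ n * inner ℝ (s.points i) y} := by
    refine convexHull_min ?_ ?_
    · rintro _ ⟨j, rfl⟩
      have h1 : 0 ≤ inner ℝ (sphereLift (s.points i)) (sphereLift (s.points j)) := by
        rcases eq_or_ne i j with rfl | hij
        · exact real_inner_self_nonneg
        · exact (hort.2 hij).ge
      rw [inner_sphereLift, le_div_iff₀ (by positivity), zero_mul] at h1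
      simp only [Set.mem_ofPred_eq]
      linarith
    · exact convex_halfSpace_ge (((n : ℝ) • innerₗ _ (s.points i)).isLinear) (-1)
  have h2 : -1 ≤ n * inner ℝ (s.points i) ((√(n : ℝ) * x.fst)⁻¹ • x.snd) := hhalf hxK
  rw [liftBasis_apply, inner_sphereLift_left]
  refine mul_nonneg (by positivity) ?_
  have h3 : (n : ℝ) * inner ℝ (s.points i) ((√(n : ℝ) * x.fst)⁻¹ • x.snd) * x.fst =
      √(n : ℝ) * inner ℝ (s.points i) x.snd := by
    have h4 : (n : ℝ) = √(n : ℝ) * √(n : ℝ) := (mul_self_sqrt n.cast_nonneg).symm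
    rw [inner_smul_right]
    conv_lhs => rw [h4, sqrt_mul_self (sqrt_nonneg _)]
    field_simp
  rw [← h3]
  nlinarith

end Main

theorem theorem2 (n : ℕ) (hn : 1 ≤ n)
    (Z : Measure (Metric.sphere (0 : EuclideanSpace ℝ (Fin n)) 1))
    (hZ : IsIsotropic Z) (hc : sphereCentroid Z = 0) :
    ENNReal.ofReal (((n : ℝ) + 1) ^ (((n : ℝ) + 1) / 2) * (n : ℝ) ^ (-(n : ℝ) / 2) /
        (n.factorial : ℝ)) ≤ volume (supportBody Z) ∧
      (volume (supportBody Z) =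
          ENNReal.ofReal (((n : ℝ) + 1) ^ (((n : ℝ) + 1) / 2) * (n : ℝ) ^ (-(n : ℝ) / 2) /
            (n.factorial : ℝ)) ↔
        IsInscribedRegularSimplex (supportBody Z)) := by
  change ENNReal.ofReal (regularSimplexVolume n) ≤ volume (supportBody Z) ∧
    (volume (supportBody Z) = ENNReal.ofReal (regularSimplexVolume n) ↔ _)
  obtain ⟨ι, _, u, c, huS, huinj, hcpos, hsum, hI⟩ := exists_finite_frame hn hZ hc
  have hu1 : ∀ i, ‖u i‖ = 1 := fun i => by
    obtain ⟨v, -, hv⟩ := huS i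
    rw [← hv, mem_sphere_zero_iff_norm.1 v.2]
  have key := le_volume_convexHull_range hn hu1 huinj hcpos hsum hI
  have hsub : convexHull ℝ (Set.range u) ⊆ supportBody Z := by
    rw [supportBody_eq]
    exact convexHull_mono (Set.range_subset_iff.2 huS)
  have hle := key.1.trans (measure_mono hsub)
  refine ⟨hle, fun heq => ?_, fun h =>
    le_antisymm (volume_le_of_isInscribedRegularSimplex hn h) hle⟩
  -- The finite subhull is squeezed to the same minimal volume, so it is the whole of `supportBody
  -- Z` and the finite equality case applies.
  have hvol := le_antisymm ((measure_mono hsub).trans heq.le) key.1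
  have hconv : Convex ℝ (supportBody Z) := convex_convexHull ℝ _
  rw [← eq_of_subset_of_volume_eq ((Set.finite_range u).isCompact_convexHull ℝ)
    (convex_convexHull ℝ _) hconv hsub (heq.trans hvol.symm)
    (by rw [hvol]; exact ENNReal.ofReal_pos.2 (regularSimplexVolume_pos hn))]
  exact key.2 hvol
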